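/- Let $n\ge 0$ be an integer, $[n]=\{1,\dots,n\}$, and for $E\subseteq[n]$ let $\mathcal P(E)=\{B\subseteq E : |B|\ge 2\}$. Let $S_n$ be the set of permutations of $[n]$ (a permutation $\sigma$ maps each item to its rank), and for a finite set $X$ let $L(X)$ be the space of functions $X\to\mathbb R$. For $A\in\mathcal P([n])$ let $\mathrm{Rank}(A)$ be the set of bijections $\pi:A\to\{1,\dots,|A|\}$, let $S_n(\pi)=\{\sigma\in S_n : \sigma(a)<\sigma(b)\text{ whenever } a,b\in A \text{ and } \pi(a)<\pi(b)\}$, and define the marginal operators $$M_A:L(S_n)\to L(\mathrm{Rank}(A)),\quad (M_Af)(\pi)=\sum_{\sigma\in S_n(\pi)}f(\sigma),\qquad M_{\mathcal A}:L(S_n)\to\bigoplus_{A\in\mathcal A}L(\mathrm{Rank}(A)),\quad M_{\mathcal A}f=(M_Af)_{A\in\mathcal A},$$ for $\mathcal A\subseteq\mathcal P([n])$. Put $\mathbb M_{\mathcal A}=M_{\mathcal A}(L(S_n))$. Let $\Gamma_n$ be the set of words over $[n]$ with pairwise distinct letters (including the empty word), and let $c(\omega)$ be the set of letters of $\omega$.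 For $a\in[n]$ let $\varrho_a:L(\Gamma_n)\to L(\Gamma_n)$ be the linear map sending the Dirac function at $\omega$ to the Dirac function at the word obtained from $\omega$ by deleting the letter $a$ (and to itself if $a\notin c(\omega)$). Let $\phi_n:L(\Gamma_n)\to L(S_n)$ be the linear map sending the Dirac function at $\pi$ to the indicator function of the set of $\sigma\in S_n$ whose word $\sigma^{-1}(1)\cdots\sigma^{-1}(n)$ contains $\pi$ as a contiguous subword. For $B\in\mathcal P([n])$ let $$H_B=\{x\in L(\Gamma_n) : x(\omega)=0\text{ if }c(\omega)\ne B,\ \text{and } \varrho_a x=0\text{ for all }a\in B\},\qquad W_B=\phi_n(H_B)\subseteq L(S_n),$$ and let $V^0\subseteq L(S_n)$ be the space of constant functions. All direct sums below are internal. (1) For every $A\in\mathcal P([n])$, $$L(S_n)=\ker M_A\oplus\Big[V^0\oplus\bigoplus_{B\in\mathcal P(A)}W_B\Big].$$ (2) For every nonempty $\mathcal A\subseteq\mathcal P([n])$, $$L(S_n)=\ker M_{\mathcal A}\oplus\Big[V^0\oplus\bigoplus_{B\in\bigcup_{A\in\mathcal A}\mathcal P(A)}W_B\Big],$$ and $$\mathbb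 M_{\mathcal A}=M_{\mathcal A}(V^0)\oplus\bigoplus_{B\in\bigcup_{A\in\mathcal A}\mathcal P(A)}M_{\mathcal A}(W_B).$$ -/

import Mathlib

open scoped BigOperators

namespace IncompleteRanking

/-- `twoSubsets E` is the collection `P(E)` of the subsets of `E` with at least two elements. -/
def twoSubsets {n : ℕ} (E : Finset (Fin n)) : Finset (Finset (Fin n)) :=
  E.powerset.filter (fun B => 2 ≤ B.card)

/-- A ranking on `A`: a bijection sending each item of `A` to its rank
(the ranks are numbered from `0` to `|A| - 1`). -/
abbrev Ranking {n : ℕ} (A : Finset (Fin n)) : Type := A ≃ Fin A.card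

/-- The set `S_n(π)` of the permutations that extend the ranking `π` on `A`.
A permutation `σ` sends each item to its rank. -/
def extensions {n : ℕ} {A : Finset (Fin n)} (π : Ranking A) : Finset (Equiv.Perm (Fin n)) :=
  Finset.univ.filter (fun σ => ∀ a b : A, π a < π b → σ a < σ b)

/-- The marginal operator `M_A : L(S_n) → L(Rank A)`, `(M_A f)(π) = ∑_{σ ∈ S_n(π)} f(σ)`. -/
def marginal {n : ℕ} (A : Finset (Fin n)) :
    (Equiv.Perm (Fin n) → ℝ) →ₗ[ℝ] (Ranking A → ℝ) where
  toFun f := fun π => ∑ σ ∈ extensions π, f σ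
  map_add' f g := by
    funext π
    simp [Finset.sum_add_distrib]
  map_smul' c f := by
    funext π
    simp [Finset.mul_sum]

/-- The joint marginal operator `M_𝒜 : L(S_n) → ⨁_{A ∈ 𝒜} L(Rank A)`, `f ↦ (M_A f)_{A ∈ 𝒜}`. -/
def marginals {n : ℕ} (𝒜 : Finset (Finset (Fin n))) :
    (Equiv.Perm (Fin n) → ℝ) →ₗ[ℝ] ((A : 𝒜) → Ranking A.1 → ℝ) :=
  LinearMap.pi (fun A => marginal A.1)

/-- The space `𝕄_𝒜 = M_𝒜(L(S_n))` of consistent families of marginals. -/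
def consistentMarginals {n : ℕ} (𝒜 : Finset (Finset (Fin n))) :
    Submodule ℝ ((A : 𝒜) → Ranking A.1 → ℝ) :=
  LinearMap.range (marginals 𝒜)

/-- The set `Γ_n` of injective words over `n` letters (including the empty word). -/
abbrev InjWord (n : ℕ) : Type := {l : List (Fin n) // l.Nodup}

/-- The content of an injective word: the set of its letters. -/
def InjWord.content {n : ℕ} (ω : InjWord n) : Finset (Fin n) := ω.1.toFinset

/-- Deletion of the letter `a` in a word (the word is unchanged if `a` does not occur in it). -/
def InjWord.delete {n : ℕ} (a : Fin n) (ω : InjWord n) : InjWord n :=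
  ⟨ω.1.erase a, ω.2.erase a⟩

/-- The injective word `a₁ … a_n` of the full ranking `a₁ ≺ … ≺ a_n`, where `a_i = σ⁻¹(i)`. -/
def permWord {n : ℕ} (σ : Equiv.Perm (Fin n)) : InjWord n :=
  ⟨List.ofFn (fun i => σ.symm i), List.nodup_ofFn.2 σ.symm.injective⟩

/-- The deletion operator `ϱ_a` on `L(Γ_n)`: the linear operator that sends the Dirac function
at `ω` to the Dirac function at the word obtained from `ω` by deleting `a`. -/
def deletion {n : ℕ} (a : Fin n) : (InjWord n → ℝ) →ₗ[ℝ] (InjWord n → ℝ) where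
  toFun x := fun π => ∑ ω ∈ Finset.univ.filter (fun ω : InjWord n => ω.delete a = π), x ω
  map_add' x y := by
    funext π
    simp [Finset.sum_add_distrib]
  map_smul' c x := by
    funext π
    simp [Finset.mul_sum]

/-- The space `H_A` of the chains `x ∈ L(Γ(A))`, that is, supported by the words of content `A`,
such that `ϱ_a x = 0` for all `a ∈ A`. -/
def spaceH {n : ℕ} (A : Finset (Fin n)) : Submodule ℝ (InjWord n → ℝ) where
  carrier := {x | (∀ ω : InjWord n, ω.content ≠ A → x ω = 0) ∧ ∀ a ∈ A, deletion a x = 0}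
  add_mem' := by
    rintro x y ⟨hx, hx'⟩ ⟨hy, hy'⟩
    refine ⟨fun ω h => ?_, fun a ha => ?_⟩
    · simp [hx ω h, hy ω h]
    · rw [map_add, hx' a ha, hy' a ha, add_zero]
  zero_mem' := ⟨fun _ _ => rfl, fun a _ => map_zero _⟩
  smul_mem' := by
    rintro c x ⟨hx, hx'⟩
    refine ⟨fun ω h => ?_, fun a ha => ?_⟩
    · simp [hx ω h]
    · rw [map_smul, hx' a ha, smul_zero]

/-- The embedding operator `φ_n : L(Γ_n) → L(S_n)`: the linear operator that sends the Dirac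
function at `π` to the indicator function of the set `S_n[π]` of the permutations whose word
contains `π` as a contiguous subword. -/
def embedding (n : ℕ) : (InjWord n → ℝ) →ₗ[ℝ] (Equiv.Perm (Fin n) → ℝ) where
  toFun x := fun σ =>
    ∑ π ∈ Finset.univ.filter (fun π : InjWord n => π.1 <:+: (permWord σ).1), x π
  map_add' x y := by
    funext σ
    simp [Finset.sum_add_distrib]
  map_smul' c x := by
    funext σ
    simp [Finset.mul_sum]

/-- The space `W_A = φ_n(H_A)`. -/
def spaceW {n : ℕ} (A : Finset (Fin n)) : Submodule ℝ (Equiv.Perm (Fin n) → ℝ) :=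
  (spaceH A).map (embedding n)

/-- The space `V⁰` of constant functions on `S_n`. -/
def constants (n : ℕ) : Submodule ℝ (Equiv.Perm (Fin n) → ℝ) :=
  Submodule.span ℝ {fun _ => (1 : ℝ)}

/-- The family of subspaces of `L(S_n)` consisting of `V⁰` and of the `W_B`, for `B ∈ 𝓑`. -/
def components {n : ℕ} (𝓑 : Finset (Finset (Fin n))) :
    Option 𝓑 → Submodule ℝ (Equiv.Perm (Fin n) → ℝ)
  | none => constants n
  | some B => spaceW B.1

end IncompleteRanking

open scoped BigOperators

namespace IncompleteRanking

/-! The claim reduces to one decomposition: L(S_n) is the direct sum of W_B over all subsets B of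
[n]. Here W_∅ = V⁰ and W_{a} = 0, which accounts for the constants and for the condition |B| ≥ 2.
Marginals are triangular for this family. If B is not contained in A, then M_A kills W_B
(`spaceW_le_ker_marginal`). On the other hand, M_B ∘ φ_n is injective on H_B
(`eq_zero_of_marginal_embedding`). Since ker M_A ⊆ ker M_B for B ⊆ A, strong induction on B shows
that when a sum of φ_n(x_B) lies in ker M_A, every x_B with B ⊆ A vanishes
(`eq_zero_of_synthesis_mem_ker`). For A = [n] this gives independence. Spanning is a dimension
count: rank-nullity for the deletion operators gives n! ≤ ∑_B dim H_B
(`finrank_functions_le_sum_finrank_spaceH`). Finally, each W_B either lies in ker M_𝒜 or has B below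
some A in 𝒜, and triangularity makes the sum of the latter meet the kernel trivially. -/

/-! ### Restricted words and kernels of marginals -/

/-- The word of `σ` restricted to the letters of `A`. -/
def restrictedWord {n : ℕ} (A : Finset (Fin n)) (σ : Equiv.Perm (Fin n)) : List (Fin n) :=
  (permWord σ).1.filter (fun a => decide (a ∈ A))

theorem mem_permWord {n : ℕ} (σ : Equiv.Perm (Fin n)) (a : Fin n) : a ∈ (permWord σ).1 := by
  simp only [permWord, List.mem_ofFn]
  exact ⟨σ a, by simp⟩

theorem permWord_pairwise {n : ℕ} (σ : Equiv.Perm (Fin n)) :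
    (permWord σ).1.Pairwise (fun a b => σ a < σ b) := by
  simp only [permWord, List.pairwise_ofFn]
  intro i j h
  simpa using h

theorem permWord_injective {n : ℕ} : Function.Injective (permWord (n := n)) := by
  intro σ τ h
  have h1 : List.ofFn (fun i => σ.symm i) = List.ofFn (fun i => τ.symm i) := congrArg Subtype.val h
  have h2 := List.ofFn_injective h1
  have h3 : σ.symm = τ.symm := Equiv.ext fun i => congrFun h2 i
  simpa using congrArg Equiv.symm h3

theorem permWord_mul_inv {n : ℕ} (σ τ : Equiv.Perm (Fin n)) :
    (permWord (σ * τ⁻¹)).1 = (permWord σ).1.map τ := by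
  simp only [permWord, List.map_ofFn]
  rfl

theorem mem_restrictedWord {n : ℕ} {A : Finset (Fin n)} {σ : Equiv.Perm (Fin n)} {a : Fin n} :
    a ∈ restrictedWord A σ ↔ a ∈ A := by
  simp [restrictedWord, mem_permWord]

theorem restrictedWord_pairwise {n : ℕ} (A : Finset (Fin n)) (σ : Equiv.Perm (Fin n)) :
    (restrictedWord A σ).Pairwise (fun a b => σ a < σ b) :=
  (permWord_pairwise σ).filter _

theorem restrictedWord_eq_iff {n : ℕ} {A : Finset (Fin n)} {σ τ : Equiv.Perm (Fin n)} :
    restrictedWord A σ = restrictedWord A τ ↔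
      ∀ a ∈ A, ∀ b ∈ A, (σ a < σ b ↔ τ a < τ b) := by
  constructor
  · intro h
    have h1 := restrictedWord_pairwise A σ
    have h2 := restrictedWord_pairwise A τ
    rw [← h] at h2
    -- The relation is symmetrised in a and b so that it passes from ordered pairs of the list to
    -- all pairs.
    have h3 : (restrictedWord A σ).Pairwise
        (fun a b => (σ a < σ b ↔ τ a < τ b) ∧ (σ b < σ a ↔ τ b < τ a)) := by
      refine (h1.and h2).imp ?_
      rintro a b ⟨h, h'⟩
      exact ⟨iff_of_true h h', iff_of_false h.asymm h'.asymm⟩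
    intro a ha b hb
    have : Std.Symm (fun a b => (σ a < σ b ↔ τ a < τ b) ∧ (σ b < σ a ↔ τ b < τ a)) :=
      ⟨fun a b h => ⟨h.2, h.1⟩⟩
    exact (h3.forall_of_forall (by simp)
      (mem_restrictedWord.2 ha) (mem_restrictedWord.2 hb)).1
  · intro h
    have hperm : (restrictedWord A σ).Perm (restrictedWord A τ) := by
      refine (List.perm_ext_iff_of_nodup ((permWord σ).2.filter _) ((permWord τ).2.filter _)).2 ?_
      intro a
      exact mem_restrictedWord.trans mem_restrictedWord.symm
    refine hperm.eq_of_pairwise (le := fun a b => σ a < σ b) ?_ (restrictedWord_pairwise A σ) ?_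
    · intro a b _ _ h1 h2
      exact absurd h1 h2.asymm
    · refine (restrictedWord_pairwise A τ).imp_of_mem ?_
      intro a b ha hb hab
      exact (h a (mem_restrictedWord.1 ha) b (mem_restrictedWord.1 hb)).2 hab

theorem mem_extensions {n : ℕ} {A : Finset (Fin n)} {π : Ranking A} {σ : Equiv.Perm (Fin n)} :
    σ ∈ extensions π ↔ ∀ a b : A, π a < π b ↔ σ a < σ b := by
  simp only [extensions, Finset.mem_filter, Finset.mem_univ, true_and]
  refine ⟨fun h a b => ⟨h a b, fun hab => ?_⟩, fun h a b => (h a b).1⟩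
  by_contra hn
  rcases (not_lt.1 hn).lt_or_eq with hlt | heq
  · exact (h b a hlt).asymm hab
  · rw [π.injective heq] at hab
    exact lt_irrefl _ hab

theorem mem_extensions_iff_restrictedWord {n : ℕ} {A : Finset (Fin n)} {π : Ranking A}
    {σ τ : Equiv.Perm (Fin n)} (hσ : σ ∈ extensions π) :
    τ ∈ extensions π ↔ restrictedWord A τ = restrictedWord A σ := by
  rw [mem_extensions] at hσ ⊢
  rw [restrictedWord_eq_iff]
  constructor
  · intro h a ha b hb
    rw [← h ⟨a, ha⟩ ⟨b, hb⟩, ← hσ ⟨a, ha⟩ ⟨b, hb⟩]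
  · intro h a b
    rw [hσ, h a a.2 b b.2]

theorem exists_mem_extensions {n : ℕ} (A : Finset (Fin n)) (σ : Equiv.Perm (Fin n)) :
    ∃ π : Ranking A, σ ∈ extensions π := by
  have hc : (A.map σ.toEmbedding).card = A.card := Finset.card_map _
  let e : A ≃ (A.map σ.toEmbedding : Finset (Fin n)) :=
    σ.subtypeEquiv (fun a => by simp)
  refine ⟨e.trans ((A.map σ.toEmbedding).orderIsoOfFin hc).symm.toEquiv, mem_extensions.2 ?_⟩
  intro a b
  change ((A.map σ.toEmbedding).orderIsoOfFin hc).symm (e a) <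
    ((A.map σ.toEmbedding).orderIsoOfFin hc).symm (e b) ↔ _
  rw [OrderIso.lt_iff_lt]
  rfl

theorem sum_restrictedWord_eq_zero {n : ℕ} {A : Finset (Fin n)} {f : Equiv.Perm (Fin n) → ℝ}
    (hf : f ∈ LinearMap.ker (marginal A)) (σ : Equiv.Perm (Fin n)) :
    ∑ τ with restrictedWord A τ = restrictedWord A σ, f τ = 0 := by
  obtain ⟨π, hπ⟩ := exists_mem_extensions A σ
  have h : ∑ τ ∈ extensions π, f τ = 0 := congrFun (LinearMap.mem_ker.1 hf) π
  rw [← h]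
  refine Finset.sum_congr ?_ fun _ _ => rfl
  ext τ
  simp [mem_extensions_iff_restrictedWord hπ]

/-- The A-restricted word determines the order on B, so the extensions of a ranking on B are a union
of fibres of `restrictedWord A`, over each of which f sums to zero. -/
theorem ker_marginal_anti {n : ℕ} {A B : Finset (Fin n)} (hBA : B ⊆ A) :
    LinearMap.ker (marginal A) ≤ LinearMap.ker (marginal B) := by
  intro f hf
  rw [LinearMap.mem_ker]
  funext π
  change ∑ σ ∈ extensions π, f σ = 0
  rw [← Finset.sum_fiberwise_of_maps_to (t := Finset.univ.image (restrictedWord A))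
    (g := restrictedWord A) (fun σ _ => Finset.mem_image_of_mem _ (Finset.mem_univ _))]
  refine Finset.sum_eq_zero fun w _ => ?_
  by_cases hne : ∃ σ ∈ extensions π, restrictedWord A σ = w
  · obtain ⟨σ, hσ, rfl⟩ := hne
    rw [← sum_restrictedWord_eq_zero hf σ]
    refine Finset.sum_congr ?_ fun _ _ => rfl
    ext τ
    simp only [Finset.mem_filter, Finset.mem_univ, true_and, and_iff_right_iff_imp]
    intro h
    rw [mem_extensions_iff_restrictedWord hσ, restrictedWord_eq_iff]
    rw [restrictedWord_eq_iff] at h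
    exact fun a ha b hb => h a (hBA ha) b (hBA hb)
  · push Not at hne
    refine Finset.sum_eq_zero fun τ hτ => ?_
    rw [Finset.mem_filter] at hτ
    exact absurd hτ.2 (hne τ hτ.1)

/-! ### Deletion operators and the dimension bound -/

theorem deletion_apply {n : ℕ} (a : Fin n) (x : InjWord n → ℝ) (π : InjWord n) :
    deletion a x π = ∑ ω with InjWord.delete a ω = π, x ω := rfl

theorem deletion_comm {n : ℕ} (a b : Fin n) (x : InjWord n → ℝ) :
    deletion a (deletion b x) = deletion b (deletion a x) := by
  have key : ∀ a b : Fin n, ∀ π, deletion a (deletion b x) π =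
      ∑ ω with InjWord.delete a (InjWord.delete b ω) = π, x ω := by
    intro a b π
    simp only [deletion_apply]
    rw [← Finset.sum_fiberwise_of_maps_to (g := InjWord.delete b)
      (t := Finset.univ.filter (fun ω : InjWord n => ω.delete a = π))
      (s := Finset.univ.filter (fun ω : InjWord n => (ω.delete b).delete a = π))]
    · refine Finset.sum_congr rfl fun ω hω => ?_
      rw [Finset.mem_filter] at hω
      refine Finset.sum_congr ?_ fun _ _ => rfl
      ext η
      simp only [Finset.mem_filter, Finset.mem_univ, true_and]
      refine ⟨fun h => ⟨by rw [h]; exact hω.2, h⟩, fun h => h.2⟩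
    · intro ω hω
      rw [Finset.mem_filter] at hω ⊢
      exact ⟨Finset.mem_univ _, hω.2⟩
  funext π
  rw [key, key]
  refine Finset.sum_congr ?_ fun _ _ => rfl
  ext ω
  have h : (ω.delete b).delete a = (ω.delete a).delete b := Subtype.ext (List.erase_comm ..)
  simp only [Finset.mem_filter, Finset.mem_univ, true_and, h]

theorem content_delete {n : ℕ} (a : Fin n) (ω : InjWord n) :
    (ω.delete a).content = ω.content.erase a := by
  ext b
  simp [InjWord.content, InjWord.delete, ω.2.mem_erase_iff]

/-- The chains supported by the words of content `B` that are killed by the deletion operators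
of the letters of `T`. -/
def chains {n : ℕ} (B T : Finset (Fin n)) : Submodule ℝ (InjWord n → ℝ) where
  carrier := {x | (∀ ω : InjWord n, ω.content ≠ B → x ω = 0) ∧ ∀ a ∈ T, deletion a x = 0}
  add_mem' := by
    rintro x y ⟨hx, hx'⟩ ⟨hy, hy'⟩
    refine ⟨fun ω h => ?_, fun a ha => ?_⟩
    · simp [hx ω h, hy ω h]
    · rw [map_add, hx' a ha, hy' a ha, add_zero]
  zero_mem' := ⟨fun _ _ => rfl, fun a _ => map_zero _⟩
  smul_mem' := by
    rintro c x ⟨hx, hx'⟩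
    refine ⟨fun ω h => ?_, fun a ha => ?_⟩
    · simp [hx ω h]
    · rw [map_smul, hx' a ha, smul_zero]

theorem chains_self {n : ℕ} (B : Finset (Fin n)) : chains B B = spaceH B := rfl

theorem deletion_mem_chains {n : ℕ} {B T : Finset (Fin n)} {a : Fin n}
    {x : InjWord n → ℝ} (hx : x ∈ chains B T) : deletion a x ∈ chains (B.erase a) T := by
  refine ⟨fun ω hω => ?_, fun b hb => ?_⟩
  · rw [deletion_apply]
    refine Finset.sum_eq_zero fun η hη => hx.1 η fun hc => hω ?_
    rw [Finset.mem_filter] at hη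
    rw [← hη.2, content_delete, hc]
  · rw [deletion_comm, hx.2 b hb, map_zero]

/-- Rank-nullity for the deletion of a: deletions commute, so it lands in `chains (B.erase a) T`,
and its kernel consists of chains also killed by a. -/
theorem finrank_chains_le_add {n : ℕ} (B T : Finset (Fin n)) (a : Fin n) :
    Module.finrank ℝ (chains B T) ≤
      Module.finrank ℝ (chains (B.erase a) T) + Module.finrank ℝ (chains B (insert a T)) := by
  let g : chains B T →ₗ[ℝ] chains (B.erase a) T :=
    (deletion a).restrict fun x hx => deletion_mem_chains hx
  rw [← g.finrank_range_add_finrank_ker]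
  refine add_le_add (Submodule.finrank_le _) ?_
  have hmem : ∀ y : LinearMap.ker g, ((y : chains B T) : InjWord n → ℝ) ∈ chains B (insert a T) := by
    intro y
    refine ⟨y.1.2.1, fun b hb => ?_⟩
    rcases Finset.mem_insert.1 hb with rfl | hb
    · exact congrArg Subtype.val (LinearMap.mem_ker.1 y.2)
    · exact y.1.2.2 b hb
  refine LinearMap.finrank_le_finrank_of_injective
    (f := ((chains B T).subtype ∘ₗ (LinearMap.ker g).subtype).codRestrict _ hmem) ?_
  intro y z h
  have h' : y.1.1 = z.1.1 := congrArg (fun w : chains B (insert a T) => w.1) h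
  exact Subtype.ext (Subtype.ext h')

theorem finrank_chains_le_sum {n : ℕ} (k : ℕ) : ∀ B T : Finset (Fin n), T ⊆ B →
    (B \ T).card = k →
    Module.finrank ℝ (chains B T) ≤ ∑ C ∈ Finset.Icc T B, Module.finrank ℝ (spaceH C) := by
  induction k with
  | zero =>
    intro B T hTB hk
    have h : B = T := (Finset.sdiff_eq_empty_iff_subset.1 (Finset.card_eq_zero.1 hk)).antisymm hTB
    subst h
    rw [Finset.Icc_self, Finset.sum_singleton, chains_self]
  | succ k ih =>
    intro B T hTB hk
    obtain ⟨a, ha⟩ : (B \ T).Nonempty := Finset.card_pos.1 (by omega)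
    obtain ⟨haB, haT⟩ := Finset.mem_sdiff.1 ha
    have hcard : ((B \ T).erase a).card = k := by rw [Finset.card_erase_of_mem ha]; omega
    refine (finrank_chains_le_add B T a).trans ?_
    refine (add_le_add (ih (B.erase a) T ?_ ?_) (ih B (insert a T) ?_ ?_)).trans ?_
    · exact Finset.subset_erase.2 ⟨hTB, haT⟩
    · rw [← hcard]; congr 1; ext; simp; tauto
    · exact Finset.insert_subset haB hTB
    · rw [← hcard]; congr 1; ext; simp; tauto
    -- The sets C between T and B split into those avoiding a and those containing a.
    · rw [← Finset.sum_union]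
      · refine (Finset.sum_le_sum_of_subset ?_)
        intro C hC
        simp only [Finset.mem_union, Finset.mem_Icc] at hC ⊢
        rcases hC with hC | hC
        · exact ⟨hC.1, hC.2.trans (Finset.erase_subset _ _)⟩
        · exact ⟨(Finset.subset_insert _ _).trans hC.1, hC.2⟩
      · rw [Finset.disjoint_left]
        intro C h1 h2
        simp only [Finset.mem_Icc] at h1 h2
        exact Finset.notMem_erase a B (h1.2 (h2.1 (Finset.mem_insert_self a T)))

/-- Only one word has content {a}, so no cancellation can occur when a is deleted. -/
theorem spaceH_singleton {n : ℕ} (a : Fin n) : spaceH ({a} : Finset (Fin n)) = ⊥ := by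
  rw [eq_bot_iff]
  intro x hx
  rw [Submodule.mem_bot]
  funext ω
  by_cases hω : ω.content = {a}
  · have h : deletion a x (ω.delete a) = 0 := by
      rw [hx.2 a (Finset.mem_singleton_self a)]; rfl
    rw [deletion_apply, Finset.sum_eq_single ω] at h
    · exact h
    · intro η hη hne
      refine hx.1 η fun hc => hne (Subtype.ext ?_)
      have hw : ∀ ξ : InjWord n, ξ.content = {a} → ξ.1 = [a] := by
        intro ξ hξ
        refine List.perm_singleton.1 ((List.perm_ext_iff_of_nodup ξ.2 (by simp)).2 fun b => ?_)
        rw [← List.mem_toFinset, show ξ.1.toFinset = {a} from hξ]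
        simp
      rw [hw η hc, hw ω hω]
    · simp
  · exact hx.1 ω hω

/-! ### Relabelling of letters and marginals of W_B -/

theorem exists_permWord_eq {n : ℕ} (l : List (Fin n)) (hl : l.Nodup) (h : ∀ a, a ∈ l) :
    ∃ σ : Equiv.Perm (Fin n), (permWord σ).1 = l := by
  have hlen : l.length = n := by
    have := List.toFinset_card_of_nodup hl
    rw [← this, Finset.eq_univ_of_forall (s := l.toFinset) (by simpa using h)]
    simp
  let e := hl.getEquivOfForallMemList l h
  refine ⟨((finCongr hlen.symm).trans e).symm, ?_⟩
  refine List.ext_getElem (by simp [permWord, hlen]) ?_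
  intro i h1 h2
  simp [permWord, e]

theorem map_eq_self_iff {α : Type*} {f : α → α} {l : List α} :
    l.map f = l ↔ ∀ a ∈ l, f a = a := by
  simpa using List.map_inj_left (l := l) (f := f) (g := id)

theorem exists_perm_map_eq {n : ℕ} {l l' : List (Fin n)} (hl : l.Nodup) (hl' : l'.Nodup)
    (h : ∀ a, a ∈ l ↔ a ∈ l') :
    ∃ τ : Equiv.Perm (Fin n), l.map τ = l' ∧ ∀ a, a ∉ l → τ a = a := by
  -- Both words are completed by the same list of missing letters, so the relabelling between the
  -- completions fixes those letters.
  have hrest : ((List.finRange n).filter (fun a => decide (a ∉ l))).Nodup :=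
    (List.nodup_finRange n).filter _
  obtain ⟨σ, hσ⟩ := exists_permWord_eq (l ++ (List.finRange n).filter (fun a => decide (a ∉ l)))
    (hl.append hrest (by intro a h1 h2; simp at h2; exact h2 h1))
    (by intro a; simp [em])
  obtain ⟨σ', hσ'⟩ := exists_permWord_eq (l' ++ (List.finRange n).filter (fun a => decide (a ∉ l)))
    (hl'.append hrest (by intro a h1 h2; simp at h2; exact h2 ((h a).2 h1)))
    (by intro a; simp [← h a, em])
  have hmap : (permWord σ).1.map (σ'⁻¹ * σ) = (permWord σ').1 := by
    rw [← permWord_mul_inv]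
    congr 2
    group
  have hlen : l.length = l'.length :=
    ((List.perm_ext_iff_of_nodup hl hl').2 h).length_eq
  rw [hσ, hσ', List.map_append] at hmap
  obtain ⟨h1, h2⟩ := List.append_inj hmap (by simpa using hlen)
  refine ⟨σ'⁻¹ * σ, h1, fun a ha => ?_⟩
  exact map_eq_self_iff.1 h2 a (by simpa using ha)

theorem mem_of_content {n : ℕ} {ω : InjWord n} {B : Finset (Fin n)} (h : ω.content = B)
    {a : Fin n} : a ∈ ω.1 ↔ a ∈ B := by
  rw [← h]; simp [InjWord.content]

theorem restrictedWord_mul_inv {n : ℕ} {A : Finset (Fin n)} {ω : List (Fin n)}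
    {σ τ : Equiv.Perm (Fin n)} (hτ : ∀ a, a ∉ ω → τ a = a)
    (hA : ω.filter (fun a => decide (a ∈ A)) = (ω.map τ).filter (fun a => decide (a ∈ A)))
    (h : ω <:+: (permWord σ).1) :
    restrictedWord A (σ * τ⁻¹) = restrictedWord A σ := by
  obtain ⟨u, v, huv⟩ := h
  have hnd : (u ++ ω ++ v).Nodup := huv ▸ (permWord σ).2
  rw [List.nodup_append', List.nodup_append'] at hnd
  have hu : u.map τ = u :=
    map_eq_self_iff.2 fun a ha => hτ a fun h => hnd.1.2.2 ha h
  have hv : v.map τ = v :=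
    map_eq_self_iff.2 fun a ha => hτ a fun h => hnd.2.2 (List.mem_append_right _ h) ha
  simp only [restrictedWord, permWord_mul_inv, ← huv, List.map_append, hu, hv, List.filter_append,
    hA]

/-- Relabelling ω into ω' inside the word of σ is injective in σ. It keeps the A-restricted word,
because ω and ω' agree after deleting b, which is not in A. By symmetry the two counts are equal. -/
theorem card_extensions_infix_le {n : ℕ} {A B : Finset (Fin n)} (π : Ranking A) {b : Fin n}
    (hb : b ∉ A) {ω ω' : InjWord n} (hω : ω.content = B) (hω' : ω'.content = B)
    (h : ω.delete b = ω'.delete b) :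
    ((extensions π).filter (fun σ => ω.1 <:+: (permWord σ).1)).card ≤
      ((extensions π).filter (fun σ => ω'.1 <:+: (permWord σ).1)).card := by
  obtain ⟨τ, hτ, hτ'⟩ := exists_perm_map_eq ω.2 ω'.2
    (fun a => (mem_of_content hω).trans (mem_of_content hω').symm)
  have hfil : ∀ l : List (Fin n), l.Nodup → l.filter (fun a => decide (a ∈ A)) =
      (l.erase b).filter (fun a => decide (a ∈ A)) := by
    intro l hl
    rw [hl.erase_eq_filter, List.filter_filter]
    refine List.filter_congr fun a _ => ?_
    by_cases ha : a ∈ A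
    · have : a ≠ b := fun h => hb (h ▸ ha)
      simp [ha, this]
    · simp [ha]
  refine Finset.card_le_card_of_injOn (fun σ => σ * τ⁻¹) ?_ (mul_left_injective _).injOn
  intro σ hσ
  simp only [Finset.coe_filter, Set.mem_ofPred_eq] at hσ ⊢
  refine ⟨(mem_extensions_iff_restrictedWord hσ.1).2 (restrictedWord_mul_inv hτ' ?_ hσ.2), ?_⟩
  · rw [hτ, hfil _ ω.2, hfil _ ω'.2]
    exact congrArg (fun w : InjWord n => w.1.filter _) h
  · rw [permWord_mul_inv, ← hτ]
    exact hσ.2.map τ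

theorem marginal_embedding {n : ℕ} {A : Finset (Fin n)} (x : InjWord n → ℝ) (π : Ranking A) :
    marginal A (embedding n x) π = ∑ ω : InjWord n,
      ((extensions π).filter (fun σ => ω.1 <:+: (permWord σ).1)).card * x ω := by
  change ∑ σ ∈ extensions π, ∑ ω with ω.1 <:+: (permWord σ).1, x ω = _
  simp only [Finset.sum_filter]
  rw [Finset.sum_comm]
  refine Finset.sum_congr rfl fun ω _ => ?_
  rw [← Finset.sum_filter, Finset.sum_const, nsmul_eq_mul]

/-- For b in B outside A, the coefficient of x ω in the marginal depends only on ω with b deleted.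
Grouping words by that deletion leaves multiples of values of ϱ_b x = 0. -/
theorem spaceW_le_ker_marginal {n : ℕ} {A B : Finset (Fin n)} (h : ¬ B ⊆ A) :
    spaceW B ≤ LinearMap.ker (marginal A) := by
  rintro _ ⟨x, hx, rfl⟩
  obtain ⟨b, hbB, hbA⟩ := Finset.not_subset.1 h
  rw [LinearMap.mem_ker]
  funext π
  rw [marginal_embedding, ← Finset.sum_fiberwise (g := InjWord.delete b)]
  refine Finset.sum_eq_zero fun η _ => ?_
  by_cases hη : ∃ ω : InjWord n, ω.delete b = η ∧ ω.content = B
  · obtain ⟨ω₀, rfl, hω₀⟩ := hη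
    have hd := congrFun (hx.2 b hbB) (ω₀.delete b)
    rw [deletion_apply] at hd
    trans ∑ ω with InjWord.delete b ω = ω₀.delete b,
      (((extensions π).filter (fun σ => ω₀.1 <:+: (permWord σ).1)).card : ℝ) * x ω
    · refine Finset.sum_congr rfl fun ω hω => ?_
      rw [Finset.mem_filter] at hω
      by_cases hc : ω.content = B
      · rw [(card_extensions_infix_le π hbA hc hω₀ hω.2).antisymm
          (card_extensions_infix_le π hbA hω₀ hc hω.2.symm)]
      · rw [hx.1 ω hc, mul_zero, mul_zero]
    · rw [← Finset.mul_sum, hd]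
      simp
  · push Not at hη
    refine Finset.sum_eq_zero fun ω hω => ?_
    rw [Finset.mem_filter] at hω
    rw [hx.1 ω (hη ω hω.2), mul_zero]

theorem restrictedWord_eq_of_infix {n : ℕ} {B : Finset (Fin n)} {ω : InjWord n}
    (hω : ω.content = B) {σ : Equiv.Perm (Fin n)} (h : ω.1 <:+: (permWord σ).1) :
    restrictedWord B σ = ω.1 := by
  have hsub : (ω.1.filter (fun a => decide (a ∈ B))).Sublist (restrictedWord B σ) :=
    h.sublist.filter _
  rw [List.filter_eq_self.2 (fun a ha => by simpa using (mem_of_content hω).1 ha)] at hsub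
  refine (hsub.eq_of_length ?_).symm
  refine ((List.perm_ext_iff_of_nodup ω.2 ((permWord σ).2.filter _)).2 fun a => ?_).length_eq
  exact (mem_of_content hω).trans mem_restrictedWord.symm

/-- A permutation containing ω contiguously ranks B in the order ω, so the marginal at that ranking
is x ω times a positive count. -/
theorem eq_zero_of_marginal_embedding {n : ℕ} {B : Finset (Fin n)} {x : InjWord n → ℝ}
    (hx : x ∈ spaceH B) (h : marginal B (embedding n x) = 0) : x = 0 := by
  funext ω
  by_cases hω : ω.content = B
  · obtain ⟨σ, hσ⟩ := exists_permWord_eq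
      (ω.1 ++ (List.finRange n).filter (fun a => decide (a ∉ ω.1)))
      (ω.2.append ((List.nodup_finRange n).filter _)
        (by intro a h1 h2; simp at h2; exact h2 h1))
      (by intro a; simp [em])
    have hin : ω.1 <:+: (permWord σ).1 := by
      rw [hσ]
      exact (List.prefix_append _ _).isInfix
    obtain ⟨π, hπ⟩ := exists_mem_extensions B σ
    have h0 := congrFun h π
    rw [marginal_embedding, Finset.sum_eq_single ω] at h0
    · refine (mul_eq_zero.1 h0).resolve_left ?_
      exact Nat.cast_ne_zero.2 (Finset.card_ne_zero_of_mem (Finset.mem_filter.2 ⟨hπ, hin⟩))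
    · intro η _ hne
      by_cases hc : η.content = B
      · rw [Finset.card_eq_zero.2, Nat.cast_zero, zero_mul]
        rw [Finset.filter_eq_empty_iff]
        intro τ hτ hinf
        rw [mem_extensions_iff_restrictedWord hπ, restrictedWord_eq_of_infix hc hinf,
          restrictedWord_eq_of_infix hω hin] at hτ
        exact hne (Subtype.ext hτ)
      · rw [hx.1 η hc, mul_zero]
    · simp
  · exact hx.1 ω hω

/-! ### The full decomposition of L(S_n) -/

theorem constants_eq_spaceW {n : ℕ} : constants n = spaceW (∅ : Finset (Fin n)) := by
  have hnil : ∀ ω : InjWord n, ω.content = ∅ ↔ ω = ⟨[], List.nodup_nil⟩ := by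
    intro ω
    rw [Subtype.ext_iff]
    exact List.toFinset_eq_empty_iff _
  have hemb : ∀ x ∈ spaceH (∅ : Finset (Fin n)),
      embedding n x = fun _ => x ⟨[], List.nodup_nil⟩ := by
    intro x hx
    funext σ
    change ∑ ω with ω.1 <:+: (permWord σ).1, x ω = _
    refine Finset.sum_eq_single _ (fun ω _ hne => hx.1 ω fun hc => hne ((hnil ω).1 hc)) ?_
    intro h
    refine absurd ?_ h
    rw [Finset.mem_filter]
    exact ⟨Finset.mem_univ _, List.nil_infix⟩
  apply le_antisymm
  · rw [constants, Submodule.span_singleton_le_iff_mem]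
    have hx : Pi.single (⟨[], List.nodup_nil⟩ : InjWord n) (1 : ℝ) ∈
        spaceH (∅ : Finset (Fin n)) := by
      refine ⟨fun ω hω => ?_, by simp⟩
      exact Pi.single_eq_of_ne (fun h => hω ((hnil ω).2 h)) _
    refine ⟨_, hx, ?_⟩
    rw [hemb _ hx]
    simp
  · rintro _ ⟨x, hx, rfl⟩
    rw [hemb x hx]
    refine Submodule.mem_span_singleton.2 ⟨x ⟨[], List.nodup_nil⟩, ?_⟩
    funext σ
    simp

theorem spaceW_singleton {n : ℕ} (a : Fin n) : spaceW ({a} : Finset (Fin n)) = ⊥ := by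
  rw [spaceW, spaceH_singleton, Submodule.map_bot]

theorem finrank_functions_le_sum_finrank_spaceH (n : ℕ) :
    Module.finrank ℝ (Equiv.Perm (Fin n) → ℝ) ≤
      ∑ B : Finset (Fin n), Module.finrank ℝ (spaceH B) := by
  have h1 : Module.finrank ℝ (Equiv.Perm (Fin n) → ℝ) ≤
      Module.finrank ℝ (chains (Finset.univ : Finset (Fin n)) ∅) := by
    -- With no deletion conditions, functions on S_n extend by zero to chains of full content.
    refine LinearMap.finrank_le_finrank_of_surjective
      (f := LinearMap.funLeft ℝ ℝ permWord ∘ₗ (chains Finset.univ ∅).subtype) fun f => ?_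
    refine ⟨⟨Function.extend permWord f 0, fun ω hω => ?_, by simp⟩, ?_⟩
    · refine Function.extend_apply' _ _ _ ?_
      rintro ⟨σ, rfl⟩
      refine hω (Finset.eq_univ_of_forall fun a => ?_)
      exact List.mem_toFinset.2 (mem_permWord σ a)
    · funext σ
      exact permWord_injective.extend_apply _ _ _
  refine h1.trans ((finrank_chains_le_sum _ _ _ (Finset.empty_subset _) rfl).trans ?_)
  exact Finset.sum_le_sum_of_subset (Finset.subset_univ _)

/-- The linear map `(x_B)_B ↦ ∑_B φ_n(x_B)`. -/
def synthesis (n : ℕ) : ((B : Finset (Fin n)) → spaceH B) →ₗ[ℝ] (Equiv.Perm (Fin n) → ℝ) :=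
  LinearMap.lsum ℝ (fun B : Finset (Fin n) => spaceH B) ℝ
    (fun B => embedding n ∘ₗ (spaceH B).subtype)

theorem synthesis_apply {n : ℕ} (x : (B : Finset (Fin n)) → spaceH B) :
    synthesis n x = ∑ B, embedding n (x B) := by
  simp [synthesis, LinearMap.lsum_apply, LinearMap.sum_apply]

/-- Under M_B, components indexed by proper subsets of B vanish by induction and those not contained
in B are killed, leaving only x B. -/
theorem eq_zero_of_synthesis_mem_ker {n : ℕ} {x : (B : Finset (Fin n)) → spaceH B}
    (A : Finset (Fin n)) (h : synthesis n x ∈ LinearMap.ker (marginal A)) :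
    ∀ B ⊆ A, x B = 0 := by
  intro B
  induction B using Finset.strongInduction with
  | H B ih =>
    intro hBA
    have hB := LinearMap.mem_ker.1 (ker_marginal_anti hBA h)
    rw [synthesis_apply, map_sum, Finset.sum_eq_single B] at hB
    · exact Subtype.ext (eq_zero_of_marginal_embedding (x B).2 hB)
    · intro C _ hne
      by_cases hC : C ⊆ B
      · rw [ih C (hC.ssubset_of_ne hne) (hC.trans hBA)]
        simp
      · exact LinearMap.mem_ker.1 (spaceW_le_ker_marginal hC ⟨x C, (x C).2, rfl⟩)
    · simp

theorem synthesis_bijective (n : ℕ) : Function.Bijective (synthesis n) := by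
  have hinj : Function.Injective (synthesis n) := by
    rw [← LinearMap.ker_eq_bot, LinearMap.ker_eq_bot']
    intro x hx
    funext B
    refine eq_zero_of_synthesis_mem_ker Finset.univ ?_ B (Finset.subset_univ B)
    rw [hx]
    exact Submodule.zero_mem _
  refine ⟨hinj, ?_⟩
  refine (LinearMap.injective_iff_surjective_of_finrank_eq_finrank ?_).1 hinj
  refine (LinearMap.finrank_le_finrank_of_injective hinj).antisymm ?_
  rw [Module.finrank_pi_fintype ℝ (M := fun B : Finset (Fin n) => spaceH B)]
  exact finrank_functions_le_sum_finrank_spaceH n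

theorem iSup_spaceW (n : ℕ) : ⨆ B : Finset (Fin n), spaceW B = ⊤ := by
  rw [eq_top_iff]
  intro f _
  obtain ⟨x, rfl⟩ := (synthesis_bijective n).2 f
  rw [synthesis_apply]
  exact Submodule.sum_mem _ fun B _ =>
    Submodule.mem_iSup_of_mem B (Submodule.mem_map_of_mem (x B).2)

theorem exists_synthesis_eq_of_mem_iSup {n : ℕ} {s : Set (Finset (Fin n))}
    {f : Equiv.Perm (Fin n) → ℝ} (hf : f ∈ ⨆ B ∈ s, spaceW B) :
    ∃ x, synthesis n x = f ∧ ∀ B ∉ s, x B = 0 := by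
  -- The intersection of kernels is the space of families vanishing outside s.
  have hle : ⨆ B ∈ s, spaceW B ≤ (⨅ B ∈ sᶜ, LinearMap.ker
      (LinearMap.proj (R := ℝ) (φ := fun B : Finset (Fin n) => spaceH B) B)).map
        (synthesis n) := by
    refine iSup₂_le fun B hB => ?_
    rintro _ ⟨y, hy, rfl⟩
    refine ⟨Pi.single B ⟨y, hy⟩, ?_, ?_⟩
    · simp only [SetLike.mem_coe, Submodule.mem_iInf]
      intro C hC
      rw [LinearMap.mem_ker, LinearMap.proj_apply]
      refine Pi.single_eq_of_ne (fun h => hC ?_) _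
      rwa [h]
    · rw [synthesis_apply, Finset.sum_eq_single B]
      · simp
      · intro C _ hne
        rw [Pi.single_eq_of_ne hne]
        simp
      · simp
  obtain ⟨x, hx, rfl⟩ := hle hf
  refine ⟨x, rfl, fun B hB => ?_⟩
  simp only [SetLike.mem_coe, Submodule.mem_iInf] at hx
  exact hx B hB

theorem iSupIndep_spaceW (n : ℕ) : iSupIndep (spaceW (n := n)) := by
  intro B
  rw [Submodule.disjoint_def]
  rintro _ ⟨y, hy, rfl⟩ hf
  obtain ⟨x, hx, hxs⟩ := exists_synthesis_eq_of_mem_iSup (s := {C | C ≠ B}) hf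
  obtain ⟨x', hx', hxs'⟩ := exists_synthesis_eq_of_mem_iSup (s := {B}) (n := n)
    (f := embedding n y) (Submodule.mem_iSup_of_mem B (Submodule.mem_iSup_of_mem rfl (Submodule.mem_map_of_mem hy)))
  have heq : x = x' := (synthesis_bijective n).1 (hx.trans hx'.symm)
  have h0 : x = 0 := by
    funext C
    by_cases hC : C = B
    · exact hxs C (by simpa using hC)
    · rw [heq]; exact hxs' C hC
  rw [← hx, h0, map_zero]

/-! ### Complements of the kernels and the image decomposition -/

theorem ker_marginals {n : ℕ} (𝒜 : Finset (Finset (Fin n))) :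
    LinearMap.ker (marginals 𝒜) = ⨅ A ∈ 𝒜, LinearMap.ker (marginal A) := by
  rw [marginals, LinearMap.ker_pi, iInf_subtype]

theorem isCompl_ker_marginals {n : ℕ} (𝒜 : Finset (Finset (Fin n))) :
    IsCompl (LinearMap.ker (marginals 𝒜))
      (⨆ B ∈ {B : Finset (Fin n) | ∃ A ∈ 𝒜, B ⊆ A}, spaceW B) := by
  constructor
  · rw [Submodule.disjoint_def]
    intro f hker hf
    obtain ⟨x, rfl, hx⟩ := exists_synthesis_eq_of_mem_iSup hf
    rw [ker_marginals] at hker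
    simp only [Submodule.mem_iInf] at hker
    have h0 : x = 0 := by
      funext B
      by_cases hB : ∃ A ∈ 𝒜, B ⊆ A
      · obtain ⟨A, hA, hBA⟩ := hB
        exact eq_zero_of_synthesis_mem_ker A (hker A hA) B hBA
      · exact hx B hB
    rw [h0, map_zero]
  · rw [codisjoint_iff, eq_top_iff, ← iSup_spaceW]
    refine iSup_le fun B => ?_
    by_cases hB : ∃ A ∈ 𝒜, B ⊆ A
    · exact le_sup_of_le_right (le_iSup₂_of_le B hB le_rfl)
    · refine le_sup_of_le_left ?_
      rw [ker_marginals]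
      push Not at hB
      exact le_iInf₂ fun A hA => spaceW_le_ker_marginal (hB A hA)

theorem components_eq_spaceW {n : ℕ} (𝓑 : Finset (Finset (Fin n))) (i : Option 𝓑) :
    components 𝓑 i = spaceW (i.elim ∅ Subtype.val) := by
  cases i with
  | none => exact constants_eq_spaceW
  | some B => rfl

theorem mem_biUnion_twoSubsets {n : ℕ} {𝒜 : Finset (Finset (Fin n))} {B : Finset (Fin n)} :
    B ∈ 𝒜.biUnion twoSubsets ↔ (∃ A ∈ 𝒜, B ⊆ A) ∧ 2 ≤ B.card := by
  simp [twoSubsets]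
  tauto

theorem iSupIndep_components {n : ℕ} (𝒜 : Finset (Finset (Fin n))) :
    iSupIndep (components (𝒜.biUnion twoSubsets)) := by
  rw [funext (components_eq_spaceW _)]
  refine (iSupIndep_spaceW n).comp (f := fun i : Option (𝒜.biUnion twoSubsets) =>
    i.elim ∅ Subtype.val) ?_
  have hne : ∀ B : 𝒜.biUnion twoSubsets, (∅ : Finset (Fin n)) ≠ B := by
    intro B h
    have := (mem_biUnion_twoSubsets.1 B.2).2
    rw [← h] at this
    simp at this
  rintro (_ | B) (_ | C) h
  · rfl
  · exact absurd h (hne C)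
  · exact absurd h.symm (hne B)
  · exact congrArg some (Subtype.ext h)

theorem iSup_components {n : ℕ} {𝒜 : Finset (Finset (Fin n))} (h𝒜 : 𝒜.Nonempty) :
    ⨆ i, components (𝒜.biUnion twoSubsets) i =
      ⨆ B ∈ {B : Finset (Fin n) | ∃ A ∈ 𝒜, B ⊆ A}, spaceW B := by
  apply le_antisymm
  · refine iSup_le fun i => ?_
    rw [components_eq_spaceW]
    refine le_iSup₂_of_le _ ?_ le_rfl
    cases i with
    | none =>
      obtain ⟨A, hA⟩ := h𝒜
      exact ⟨A, hA, Finset.empty_subset A⟩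
    | some B => exact (mem_biUnion_twoSubsets.1 B.2).1
  · refine iSup₂_le fun B hB => ?_
    -- The empty set contributes the constants and singletons contribute nothing.
    rcases Nat.lt_or_ge B.card 2 with hc | hc
    · rcases Nat.lt_or_ge B.card 1 with hc' | hc'
      · have h0 : B = ∅ := Finset.card_eq_zero.1 (by omega)
        rw [h0, ← constants_eq_spaceW]
        exact le_iSup (components (𝒜.biUnion twoSubsets)) none
      · obtain ⟨a, rfl⟩ := Finset.card_eq_one.1 (show B.card = 1 by omega)
        rw [spaceW_singleton]
        exact bot_le
    · exact le_iSup (components (𝒜.biUnion twoSubsets))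
        (some ⟨B, mem_biUnion_twoSubsets.2 ⟨hB, hc⟩⟩)

/-- The map is injective on the sum of the p i, hence preserves independence. -/
theorem iSupIndep_map_of_disjoint_ker {ι V W : Type*} [AddCommGroup V] [Module ℝ V]
    [AddCommGroup W] [Module ℝ W] {p : ι → Submodule ℝ V} (hp : iSupIndep p) (f : V →ₗ[ℝ] W)
    (hf : Disjoint (LinearMap.ker f) (⨆ i, p i)) : iSupIndep fun i => (p i).map f := by
  intro i
  simp only [← Submodule.map_iSup]
  rw [Submodule.disjoint_def]
  rintro _ ⟨a, ha, rfl⟩ ⟨b, hb, hab⟩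
  have hb' : b ∈ ⨆ i, p i := (iSup₂_le fun j _ => le_iSup p j) hb
  have h0 : b - a = 0 := (Submodule.disjoint_def.1 hf) _
    (by rw [LinearMap.mem_ker, map_sub, hab, sub_self])
    (Submodule.sub_mem _ hb' (Submodule.mem_iSup_of_mem i ha))
  rw [sub_eq_zero] at h0
  subst h0
  rw [Submodule.disjoint_def.1 (hp i) b ha hb, map_zero]

theorem map_eq_range_of_codisjoint_ker {V W : Type*} [AddCommGroup V] [Module ℝ V]
    [AddCommGroup W] [Module ℝ W] (f : V →ₗ[ℝ] W) {S : Submodule ℝ V}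
    (h : Codisjoint (LinearMap.ker f) S) : S.map f = LinearMap.range f := by
  have hbot : (LinearMap.ker f).map f = ⊥ := (Submodule.map_le_iff_le_comap).2 le_rfl |> le_bot_iff.1
  rw [LinearMap.range_eq_map, ← codisjoint_iff.1 h, Submodule.map_sup, hbot, bot_sup_eq]

end IncompleteRanking

open IncompleteRanking in
theorem mainTheorem2 (n : ℕ) :
    (∀ A ∈ twoSubsets (Finset.univ : Finset (Fin n)),
      iSupIndep (components (twoSubsets A)) ∧
      IsCompl (LinearMap.ker (marginal A)) (⨆ i, components (twoSubsets A) i)) ∧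
    (∀ 𝒜 : Finset (Finset (Fin n)), 𝒜 ⊆ twoSubsets Finset.univ → 𝒜.Nonempty →
      iSupIndep (components (𝒜.biUnion twoSubsets)) ∧
      IsCompl (LinearMap.ker (marginals 𝒜)) (⨆ i, components (𝒜.biUnion twoSubsets) i) ∧
      iSupIndep (fun i => (components (𝒜.biUnion twoSubsets) i).map (marginals 𝒜)) ∧
      consistentMarginals 𝒜 =
        ⨆ i, (components (𝒜.biUnion twoSubsets) i).map (marginals 𝒜)) := by
  have hcompl : ∀ 𝒜 : Finset (Finset (Fin n)), 𝒜.Nonempty →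
      IsCompl (LinearMap.ker (marginals 𝒜)) (⨆ i, components (𝒜.biUnion twoSubsets) i) := by
    intro 𝒜 h𝒜
    rw [iSup_components h𝒜]
    exact isCompl_ker_marginals 𝒜
  refine ⟨fun A _ => ?_, fun 𝒜 _ h𝒜 => ?_⟩
  · have hind := iSupIndep_components {A}
    have hc := hcompl {A} (Finset.singleton_nonempty A)
    rw [ker_marginals, Finset.singleton_biUnion] at hc
    rw [Finset.singleton_biUnion] at hind
    refine ⟨hind, ?_⟩
    simpa using hc
  · refine ⟨iSupIndep_components 𝒜, hcompl 𝒜 h𝒜,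
      iSupIndep_map_of_disjoint_ker (iSupIndep_components 𝒜) _ (hcompl 𝒜 h𝒜).disjoint, ?_⟩
    rw [← Submodule.map_iSup, map_eq_range_of_codisjoint_ker _ (hcompl 𝒜 h𝒜).codisjoint]
    rfl
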